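/- Let $m,a$ be positive integers, and let $\hat{\mathcal B}_m^{[0,a]}$ be the arrangement of the hyperplanes $x_i=k$ $(1\le i\le m)$, $x_i-x_j=k$ and $x_i+x_j=k$ $(1\le i<j\le m)$, where $k=0,1,\dots,a$. For a positive integer $q$, let $M_q$ be the set of all $z\in(\mathbb Z/q\mathbb Z)^m$ that satisfy none of these equations modulo $q$. Let $S$ be the shift operator on polynomials, $(Sf)(y)=f(y-1)$, let $\phi_b(y)=1+y+\cdots+y^{b-1}$, and let operators in $S$ act on $q^m$ regarded as a polynomial in $q$. (1) If $a$ is odd, then for all $q\ge 2a(m+1)-1$ $$|M_q|=\frac{1}{a^{m+1}}\,S^{2m}\{\phi_a(S^2)\}^{m-1}\{\phi_a(S)\}^2\,q^m ,$$ so that $|M_q|$ is given by a single polynomial in $q$. (2) If $a$ is even, then for all $q\ge 2a(m+1)-1$ $$|M_q|=\begin{cases} \dfrac{4}{a^{m+1}}\,S^{2m+1}\{\phi_a(S^2)\}^{m-1}\{\phi_{a/2}(S^2)\}^2\,q^m & \text{if } q \text{ is odd},\\[2mm] \dfrac{2}{a^{m+1}}\,S^{2m}\{\phi_a(S^2)\}^{m-1}\{\phi_{a/2}(S^2)\}^2(1+S^2)\,q^m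 & \text{if } q \text{ is even}, \end{cases}$$ and, if moreover $m\ge 2$, these two polynomials in $q$ are distinct. -/

import Mathlib

open Polynomial

noncomputable section

/-- The hyperplane `H_{j,q}` of `ℤ_q^m` defined modulo `q` by the `j`-th column of the integral
coefficient matrix `C` and the `j`-th constant `b j`, that is `∑ i, z_i c_{ij} = b_j` in `ℤ_q`. -/
def hyperplaneMod {m : ℕ} {ι : Type} (C : Matrix (Fin m) ι ℤ) (b : ι → ℤ) (q : ℕ) (j : ι) :
    Set (Fin m → ZMod q) :=
  {z | ∑ i, z i * (C i j : ZMod q) = (b j : ZMod q)}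

/-- The complement `M(𝒜_q)` of the arrangement `𝒜_q = {H_{j,q}}` in `ℤ_q^m`. -/
def complementMod {m : ℕ} {ι : Type} (C : Matrix (Fin m) ι ℤ) (b : ι → ℤ) (q : ℕ) :
    Set (Fin m → ZMod q) :=
  Set.univ \ ⋃ j, hyperplaneMod C b q j

/-- Labels of the hyperplanes of the arrangement `\hat B_m^{[0,a]}`. -/
inductive BHatIndex (m a : ℕ) : Type
  /-- `x_i = k` with `0 ≤ k ≤ a` -/
  | coord (i : Fin m) (k : Fin (a + 1))
  /-- `x_i - x_j = k` with `i < j`, `0 ≤ k ≤ a` -/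
  | diff (i j : Fin m) (hij : i < j) (k : Fin (a + 1))
  /-- `x_i + x_j = k` with `i < j`, `0 ≤ k ≤ a` -/
  | sum (i j : Fin m) (hij : i < j) (k : Fin (a + 1))

/-- The coefficient vector of each hyperplane of `\hat B_m^{[0,a]}` (entries `0, 1, -1`). -/
def BHatIndex.coeff {m a : ℕ} : BHatIndex m a → Fin m → ℤ
  | .coord i _ => Pi.single i 1
  | .diff i j _ _ => Pi.single i 1 - Pi.single j 1
  | .sum i j _ _ => Pi.single i 1 + Pi.single j 1

/-- The coefficient matrix `C` of `\hat B_m^{[0,a]}`. -/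
def bHatMatrix (m a : ℕ) : Matrix (Fin m) (BHatIndex m a) ℤ :=
  Matrix.of fun i h => h.coeff i

/-- The vector `b` of constants of `\hat B_m^{[0,a]}`. -/
def bHatConst (m a : ℕ) : BHatIndex m a → ℤ
  | .coord _ k => (k : ℕ)
  | .diff _ _ _ k => (k : ℕ)
  | .sum _ _ _ k => (k : ℕ)

/-- `|M((\hat B_m^{[0,a]})_q)|`. -/
def bHatCount (m a q : ℕ) : ℕ :=
  (complementMod (bHatMatrix m a) (bHatConst m a) q).ncard

/-- `φ_b(y) = 1 + y + ⋯ + y^{b-1}`. -/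
def phiPoly (b : ℕ) : ℚ[X] := ∑ i ∈ Finset.range b, X ^ i

/-- The shift operator `(S f)(y) = f(y - 1)` on polynomials. -/
def shiftOp : Module.End ℚ ℚ[X] := taylor (-1)

/-- `a^{-(m+1)} S^{2m} φ_a(S²)^{m-1} φ_a(S)² q^m`, as a polynomial in `q`. -/
def bHatPolyOddA (m a : ℕ) : ℚ[X] :=
  (1 / (a : ℚ) ^ (m + 1)) •
    (shiftOp ^ (2 * m) * aeval (shiftOp ^ 2) (phiPoly a) ^ (m - 1) *
      aeval shiftOp (phiPoly a) ^ 2 : Module.End ℚ ℚ[X]) (X ^ m)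

/-- `4 a^{-(m+1)} S^{2m+1} φ_a(S²)^{m-1} φ_{a/2}(S²)² q^m`, as a polynomial in `q`
(used for even `a` and odd `q`). -/
def bHatPolyEvenAOddQ (m a : ℕ) : ℚ[X] :=
  (4 / (a : ℚ) ^ (m + 1)) •
    (shiftOp ^ (2 * m + 1) * aeval (shiftOp ^ 2) (phiPoly a) ^ (m - 1) *
      aeval (shiftOp ^ 2) (phiPoly (a / 2)) ^ 2 : Module.End ℚ ℚ[X]) (X ^ m)

/-- `2 a^{-(m+1)} S^{2m} φ_a(S²)^{m-1} φ_{a/2}(S²)² (1 + S²) q^m`, as a polynomial in `q`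
(used for even `a` and even `q`). -/
def bHatPolyEvenAEvenQ (m a : ℕ) : ℚ[X] :=
  (2 / (a : ℚ) ^ (m + 1)) •
    (shiftOp ^ (2 * m) * aeval (shiftOp ^ 2) (phiPoly a) ^ (m - 1) *
      aeval (shiftOp ^ 2) (phiPoly (a / 2)) ^ 2 * (1 + shiftOp ^ 2) :
        Module.End ℚ ℚ[X]) (X ^ m)

end

/-! ### Symmetric labelled configurations on a segment -/

noncomputable section

/-! Lift `z` to integers in `[0, q)` and put the coordinates and their mirror images `q - x_i` on a
segment of length `q`, with signed labels `±1, …, ±m`. All equations of the arrangement then say the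
same thing: neighbours are at distance at least 1, and at least `1 + a` where the label increases
from left to right, the left end having label 0. So `|M_q|` is a `signedCount` with parameters `(1,
a)`. With parameters `(0, 1)` the same conditions only say `1 ≤ x_i ≤ L`, and the count is `L^m`.

The two counts are compared by removing the first point `v` and its mirror image
(`signedCount_sub`). In generating functions, `(1 - y²) F(T, u) = ∑_v y^{2(e + a[u<v])} F(T \ {±v},
v)`. Substituting `y ↦ y^a` in the `(0, 1)` recurrence gives the same sum with `e = 0` and `1 -
y^{2a}` on the left, so each removed pair contributes a factor `y² φ_a(y²)`; the last pair has no
mutual constraint and contributes `(y φ_a(y))²` (`countSeq_eq_aeval_seqDilate`). Hence `a^m |M_q|`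
is `gapPoly` in the shift, applied to `k^m` restricted to multiples of `a` (`bHatCount_mul_pow`).

The restriction is removed by `phiPoly_pow_residueDefect`: a factor `φ_b(S^c)^{m+1}` cannot tell
apart the classes modulo `cb` within one class modulo `c` on polynomials of degree `m`. For odd `a`
this applies with `c = 1`, `b = a`. For `a = 2b` it applies with `c = 2`, so the parity of `k`
survives and yields two constituents. Their difference carries `(1 - S)²`, which does not kill `q^m`
when `m ≥ 2`. -/

/-- Configurations of points labelled by the symmetric set `T` of signed labels on a segment of
length `L` whose left end carries the label `u`: the label `-s` sits at the mirror image of `s`,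
and a label is preceded by a smaller one only at distance at least `e + a`. -/
def signedConfig (e a : ℤ) (T : Finset ℤ) (u L : ℤ) : Set (ℤ → ℤ) :=
  {p | (∀ s, s ∉ T → p s = 0) ∧ (∀ s ∈ T, p (-s) = L - p s) ∧
    (∀ s ∈ T, e + (if u < s then a else 0) ≤ p s) ∧
    ∀ s ∈ T, ∀ t ∈ T, s ≠ t → s ≠ -t → p s ≤ p t →
      e ≤ p t - p s ∧ (s < t → p s ≠ p t → e + a ≤ p t - p s)}

/-- The number of configurations. -/
def signedCount (e a : ℤ) (T : Finset ℤ) (u L : ℤ) : ℕ := Nat.card (signedConfig e a T u L)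

/-- Remove the label `v` and its mirror image. -/
def erasePair (T : Finset ℤ) (v : ℤ) : Finset ℤ := (T.erase v).erase (-v)

lemma mem_erasePair {T : Finset ℤ} {v s : ℤ} : s ∈ erasePair T v ↔ s ≠ -v ∧ s ≠ v ∧ s ∈ T := by
  simp [erasePair]

/-- A finite set of nonzero integers that is stable under negation. -/
def IsSignedSet (T : Finset ℤ) : Prop := 0 ∉ T ∧ ∀ s ∈ T, -s ∈ T

lemma IsSignedSet.erasePair {T : Finset ℤ} (hT : IsSignedSet T) (v : ℤ) :
    IsSignedSet (erasePair T v) := by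
  refine ⟨fun h => hT.1 (mem_erasePair.1 h).2.2, fun s hs => ?_⟩
  obtain ⟨h1, h2, h3⟩ := mem_erasePair.1 hs
  exact mem_erasePair.2 ⟨fun h => h2 (by omega), fun h => h1 (by omega), hT.2 s h3⟩

lemma IsSignedSet.card_erasePair {T : Finset ℤ} (hT : IsSignedSet T) {v : ℤ} (hv : v ∈ T) :
    (_root_.erasePair T v).card + 2 = T.card := by
  have h0 : v ≠ 0 := fun h => hT.1 (h ▸ hv)
  have h1 : -v ∈ T.erase v := Finset.mem_erase.2 ⟨by omega, hT.2 v hv⟩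
  have := Finset.card_erase_add_one h1
  have := Finset.card_erase_add_one hv
  unfold _root_.erasePair
  omega

/-! ### Recurrence by removal of the first point -/

section Recurrence

variable {e a : ℤ} {T : Finset ℤ} {u L : ℤ}

lemma signedConfig_nonneg (he : 0 ≤ e) (ha : 0 < a) {p : ℤ → ℤ} (hp : p ∈ signedConfig e a T u L)
    {s : ℤ} (hs : s ∈ T) : 0 ≤ p s := by
  have := hp.2.2.1 s hs
  split_ifs at this <;> omega

lemma signedConfig_finite (he : 0 ≤ e) (ha : 0 < a) (hT : IsSignedSet T) :
    Finite (signedConfig e a T u L) := by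
  let F : signedConfig e a T u L → (T → Set.Icc 0 L) := fun p s => ⟨p.1 s.1, by
    have h1 := signedConfig_nonneg he ha p.2 s.2
    have h2 := signedConfig_nonneg he ha p.2 (hT.2 _ s.2)
    have h3 := p.2.2.1 s.1 s.2
    exact ⟨h1, by omega⟩⟩
  refine Finite.of_injective F fun p r h => Subtype.ext (funext fun s => ?_)
  by_cases hs : s ∈ T
  · have := congrArg Subtype.val (congrFun h ⟨s, hs⟩)
    exact this
  · rw [p.2.1 s hs, r.2.1 s hs]

lemma signedCount_of_neg (he : 0 ≤ e) (ha : 0 < a) (hT : IsSignedSet T) (hne : T.Nonempty)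
    (hL : L < 0) : signedCount e a T u L = 0 := by
  have : IsEmpty (signedConfig e a T u L) := by
    refine ⟨fun p => ?_⟩
    obtain ⟨s, hs⟩ := hne
    have h1 := signedConfig_nonneg he ha p.2 hs
    have h2 := signedConfig_nonneg he ha p.2 (hT.2 _ hs)
    have h3 := p.2.2.1 s hs
    omega
  exact Nat.card_of_isEmpty

/-- The configuration on `T` whose first point is `v`, at position `g`. -/
def prependPoint (T : Finset ℤ) (L v g : ℤ) (p : ℤ → ℤ) : ℤ → ℤ := fun s =>
  if s ∈ erasePair T v then p s + g else if s = v then g else if s = -v then L - g else 0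

lemma prependPoint_of_mem {v g s : ℤ} {p : ℤ → ℤ} (hs : s ∈ erasePair T v) :
    prependPoint T L v g p s = p s + g := by simp [prependPoint, hs]

lemma prependPoint_self {v g : ℤ} {p : ℤ → ℤ} : prependPoint T L v g p v = g := by
  simp [prependPoint, erasePair]

lemma prependPoint_neg (hT : IsSignedSet T) {v g : ℤ} (hv : v ∈ T) {p : ℤ → ℤ} :
    prependPoint T L v g p (-v) = L - g := by
  have h0 : v ≠ 0 := fun h => hT.1 (h ▸ hv)
  have : -v ≠ v := by omega
  simp [prependPoint, erasePair, this]

lemma eq_or_eq_or_mem_erasePair {s : ℤ} (v : ℤ) (hs : s ∈ T) :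
    s = v ∨ s = -v ∨ s ∈ erasePair T v := by
  rw [mem_erasePair]; tauto

/-- Conditions between neighbours suffice: if `u < s`, then `u < v` or `v < s`, so the extra `a` is
already paid on one side of `v`. Bounds at the right end follow by reflection. -/
lemma prependPoint_mem (he : 0 ≤ e) (ha : 0 < a) (hT : IsSignedSet T) (hc : 2 < T.card)
    {v g : ℤ} (hv : v ∈ T) (hg : e + (if u < v then a else 0) ≤ g) {p : ℤ → ℤ}
    (hp : p ∈ signedConfig e a (erasePair T v) v (L - 2 * g)) :
    prependPoint T L v g p ∈ signedConfig e a T u L := by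
  have hT' := hT.erasePair v
  have hcard := hT.card_erasePair hv
  obtain ⟨l, hl⟩ : (erasePair T v).Nonempty := Finset.card_pos.1 (by omega)
  obtain ⟨hp0, hp1, hp2, hp3⟩ := hp
  have hself := prependPoint_self (T := T) (L := L) (v := v) (g := g) (p := p)
  have hneg := prependPoint_neg (L := L) (g := g) hT hv (p := p)
  have hmem : ∀ s, s ∈ erasePair T v → prependPoint T L v g p s = p s + g :=
    fun s hs => prependPoint_of_mem hs
  set r := prependPoint T L v g p with hr
  have hsym : ∀ s ∈ T, r (-s) = L - r s := by
    intro s hs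
    rcases eq_or_eq_or_mem_erasePair v hs with rfl | rfl | h
    · rw [hneg, hself]
    · rw [neg_neg, hneg, hself]; ring
    · rw [hmem _ h, hmem _ (hT'.2 _ h), hp1 _ h]; ring
  -- comparison of the first point with the others
  have hfirst : ∀ s ∈ erasePair T v, e + (if v < s then a else 0) ≤ r s - r v := by
    intro s hs
    have := hp2 s hs
    rw [hmem _ hs, hself]; linarith
  refine ⟨fun s hs => ?_, hsym, fun s hs => ?_, fun s hs t ht hst hst' hle => ?_⟩
  · have h1 : s ∉ erasePair T v := fun h => hs (mem_erasePair.1 h).2.2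
    have h2 : s ≠ v := fun h => hs (h ▸ hv)
    have h3 : s ≠ -v := fun h => hs (h ▸ hT.2 v hv)
    simp [hr, prependPoint, h1, h2, h3]
  · rcases eq_or_eq_or_mem_erasePair v hs with rfl | rfl | h
    · rwa [hself]
    -- As more than two labels are present, some other pair `±l` exists; adding its two bounds keeps
    -- `-v` far enough to the right of `v`.
    · have h1 := hfirst l hl
      have h2 := hfirst (-l) (hT'.2 _ hl)
      have h3 := hsym l (mem_erasePair.1 hl).2.2
      have h4 := hsym v hv
      split_ifs at * <;> omega
    · have h1 := hfirst s h
      split_ifs at * <;> omega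
  · rcases eq_or_eq_or_mem_erasePair v hs with rfl | rfl | h
    · have ht' : t ∈ erasePair T s := mem_erasePair.2 ⟨fun h => hst' (by omega), hst.symm, ht⟩
      have h1 := hfirst t ht'
      split_ifs at * <;> omega
    · have ht' : t ∈ erasePair T v := mem_erasePair.2 ⟨hst.symm, fun h => hst' (by omega), ht⟩
      have h1 := hfirst (-t) (hT'.2 _ ht')
      have h2 := hsym t ht
      have h3 := hsym v hv
      split_ifs at * <;> omega
    · rcases eq_or_eq_or_mem_erasePair v ht with rfl | rfl | h'
      · have h1 := hfirst s h
        split_ifs at * <;> omega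
      · have h1 := hfirst (-s) (hT'.2 _ h)
        have h2 := hsym s hs
        have h3 := hsym v hv
        split_ifs at * <;> omega
      · rw [hmem _ h, hmem _ h'] at *
        have := hp3 s h t h' hst hst' (by omega)
        refine ⟨by omega, fun h1 h2 => ?_⟩
        have := this.2 h1 (by omega)
        omega

/-- In `prependPoint`, the label `v` is the largest one among those in the first position. -/
lemma prependPoint_first (he : 0 ≤ e) (ha : 0 < a) (hT : IsSignedSet T) (hc : 2 < T.card)
    {v g : ℤ} (hv : v ∈ T) {p : ℤ → ℤ}
    (hp : p ∈ signedConfig e a (erasePair T v) v (L - 2 * g)) {s : ℤ} (hs : s ∈ T) :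
    g ≤ prependPoint T L v g p s ∧ (prependPoint T L v g p s = g → s ≤ v) := by
  have hT' := hT.erasePair v
  have hcard := hT.card_erasePair hv
  obtain ⟨l, hl⟩ : (erasePair T v).Nonempty := Finset.card_pos.1 (by omega)
  obtain ⟨hp0, hp1, hp2, hp3⟩ := hp
  rcases eq_or_eq_or_mem_erasePair v hs with rfl | rfl | h
  · rw [prependPoint_self]; simp
  · rw [prependPoint_neg hT hv]
    have h1 := hp2 l hl
    have h2 := hp2 (-l) (hT'.2 _ hl)
    have h3 := hp1 l hl
    split_ifs at * <;> omega
  · rw [prependPoint_of_mem h]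
    have h1 := hp2 s h
    split_ifs at * <;> omega

lemma exists_prependPoint (hT : IsSignedSet T) (hne : T.Nonempty)
    {r : ℤ → ℤ} (hr : r ∈ signedConfig e a T u L) :
    ∃ v ∈ T, ∃ g, e + (if u < v then a else 0) ≤ g ∧
      ∃ p ∈ signedConfig e a (erasePair T v) v (L - 2 * g), prependPoint T L v g p = r := by
  obtain ⟨hr0, hr1, hr2, hr3⟩ := hr
  obtain ⟨w, hw, hwmin⟩ := Finset.exists_min_image T r hne
  -- Ties occur when `e = 0`. Reading tied labels in decreasing order creates no ascent, so the
  -- largest label in the leftmost position is taken as the first.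
  obtain ⟨v, hv, hvmax⟩ := Finset.exists_max_image (T.filter fun s => r s = r w) id
    ⟨w, by simp [hw]⟩
  obtain ⟨hvT, hvw⟩ := Finset.mem_filter.1 hv
  refine ⟨v, hvT, r v, hr2 v hvT, fun s => if s ∈ erasePair T v then r s - r v else 0, ?_, ?_⟩
  · refine ⟨fun s hs => by simp [hs], fun s hs => ?_, fun s hs => ?_,
      fun s hs t ht hst hst' hle => ?_⟩
    · have h1 := hr1 s (mem_erasePair.1 hs).2.2
      simp only [hs, (hT.erasePair v).2 s hs, if_true, h1]; ring
    · obtain ⟨h1, h2, h3⟩ := mem_erasePair.1 hs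
      have h4 := hwmin s h3
      have h5 := hr3 v hvT s h3 (Ne.symm h2) (fun h => h1 (by omega)) (by omega)
      have h6 : v < s → r s ≠ r w := fun h h' => by
        have := hvmax s (Finset.mem_filter.2 ⟨h3, h'⟩)
        simp at this; omega
      simp only [hs, if_true]
      split_ifs with h
      · exact h5.2 h (by have := h6 h; omega)
      · omega
    · simp only [hs, ht, if_true] at hle ⊢
      have h1 := hr3 s (mem_erasePair.1 hs).2.2 t (mem_erasePair.1 ht).2.2 hst hst' (by omega)
      refine ⟨by omega, fun h2 h3 => ?_⟩
      have := h1.2 h2 (by omega)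
      omega
  · funext s
    by_cases hs : s ∈ erasePair T v
    · simp [prependPoint, hs]
    · simp only [prependPoint, hs, if_false]
      split_ifs with h1 h2
      · rw [h1]
      · rw [h2, hr1 v hvT]
      · refine (hr0 s fun h => ?_).symm
        exact hs (mem_erasePair.2 ⟨h2, h1, h⟩)

/-- Counting configurations by their first point. -/
lemma signedCount_eq_sum (he : 0 ≤ e) (ha : 0 < a) (hT : IsSignedSet T) (hc : 2 < T.card)
    (K : ℕ) (hK : L < K) :
    signedCount e a T u L = ∑ v ∈ T, ∑ h ∈ Finset.range K,
      signedCount e a (erasePair T v) v (L - 2 * (e + if u < v then a else 0) - 2 * h) := by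
  let F : (Σ v : T, Σ h : Fin K, signedConfig e a (erasePair T v.1) v.1
      (L - 2 * (e + (if u < v.1 then a else 0) + h.1))) → signedConfig e a T u L := fun x =>
    ⟨prependPoint T L x.1.1 (e + (if u < x.1.1 then a else 0) + x.2.1.1) x.2.2.1,
      prependPoint_mem he ha hT hc x.1.2 (by omega) x.2.2.2⟩
  have hF : Function.Bijective F := by
    constructor
    · rintro ⟨⟨v, hv⟩, h, p, hp⟩ ⟨⟨v', hv'⟩, h', p', hp'⟩ heq
      have heq' := congrArg Subtype.val heq
      simp only [F] at heq'
      set g := e + (if u < v then a else 0) + (h.1 : ℤ) with hg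
      set g' := e + (if u < v' then a else 0) + (h'.1 : ℤ) with hg'
      have f1 := prependPoint_first he ha hT hc hv hp hv'
      have f2 := prependPoint_first he ha hT hc hv' hp' hv
      have f3 := prependPoint_self (T := T) (L := L) (v := v) (g := g) (p := p)
      have f4 := prependPoint_self (T := T) (L := L) (v := v') (g := g') (p := p')
      rw [heq', f4] at f1
      rw [← heq', f3] at f2
      have hgg : g = g' := by omega
      have hvv : v = v' := le_antisymm (f2.2 hgg) (f1.2 hgg.symm)
      subst hvv
      have hhh : h = h' := Fin.ext (by omega)
      subst hhh
      have : p = p' := by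
        funext s
        by_cases hs : s ∈ erasePair T v
        · have := congrFun heq' s
          rw [prependPoint_of_mem hs, prependPoint_of_mem hs] at this
          omega
        · rw [hp.1 s hs, hp'.1 s hs]
      subst this
      rfl
    · rintro ⟨r, hr⟩
      obtain ⟨v, hv, g, hg, p, hp, hpr⟩ := exists_prependPoint hT (Finset.card_pos.1 (by omega)) hr
      have hgL : g ≤ L := by
        have h1 := signedConfig_nonneg he ha hr (hT.2 v hv)
        rw [← hpr, prependPoint_neg hT hv] at h1
        omega
      obtain ⟨h, hh⟩ : ∃ h : ℕ, g = e + (if u < v then a else 0) + h :=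
        ⟨(g - (e + (if u < v then a else 0))).toNat, by omega⟩
      have hhK : h < K := by split_ifs at hh <;> omega
      subst hh
      exact ⟨⟨⟨v, hv⟩, ⟨h, hhK⟩, p, hp⟩, Subtype.ext hpr⟩
  have : ∀ v L, Finite (signedConfig e a (erasePair T v) v L) :=
    fun v L => signedConfig_finite he ha (hT.erasePair v)
  rw [signedCount, ← Nat.card_congr (Equiv.ofBijective F hF), Nat.card_sigma]
  rw [← Finset.sum_coe_sort T]
  refine Finset.sum_congr rfl fun v _ => ?_
  rw [Nat.card_sigma, ← Fin.sum_univ_eq_sum_range (fun h => signedCount e a (erasePair T v.1) v.1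
    (L - 2 * (e + if u < v.1 then a else 0) - 2 * (h : ℤ)))]
  refine Finset.sum_congr rfl fun h _ => ?_
  rw [signedCount, mul_add, sub_add_eq_sub_sub]

/-- Sum over the slack `h` of the first point: its mirror image moves too, so each unit of slack
costs 2 in length, and differencing by 2 leaves only `h = 0`. -/
lemma signedCount_sub (he : 0 ≤ e) (ha : 0 < a) (hT : IsSignedSet T) (hc : 2 < T.card) :
    signedCount e a T u L = signedCount e a T u (L - 2) + ∑ v ∈ T,
      signedCount e a (erasePair T v) v (L - 2 * (e + if u < v then a else 0)) := by
  obtain ⟨K, hK⟩ : ∃ K : ℕ, L < K := ⟨(L + 1).toNat, by omega⟩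
  rw [signedCount_eq_sum he ha hT hc (K + 1) (by push_cast; omega),
    signedCount_eq_sum (L := L - 2) he ha hT hc K (by omega), ← Finset.sum_add_distrib]
  refine Finset.sum_congr rfl fun v _ => ?_
  rw [Finset.sum_range_succ']
  congr 1
  · refine Finset.sum_congr rfl fun h _ => ?_
    congr 1; push_cast; ring
  · simp

/-- Configurations with one pair of labels. -/
lemma signedCount_pair {l : ℤ} (hl : l ≠ 0) :
    signedCount e a {l, -l} u L = (L + 1 - (e + if u < l then a else 0) -
      (e + if u < -l then a else 0)).toNat := by
  let F : signedConfig e a {l, -l} u L →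
      Set.Icc (e + if u < l then a else 0) (L - (e + if u < -l then a else 0)) := fun p =>
    ⟨p.1 l, p.2.2.2.1 l (by simp), by
      have h1 := p.2.2.2.1 (-l) (by simp)
      have h2 := p.2.2.1 l (by simp)
      omega⟩
  have hF : Function.Bijective F := by
    constructor
    · intro p r h
      have h0 : p.1 l = r.1 l := congrArg Subtype.val h
      refine Subtype.ext (funext fun s => ?_)
      by_cases hs : s ∈ ({l, -l} : Finset ℤ)
      · rcases (by simpa using hs : s = l ∨ s = -l) with rfl | rfl
        · exact h0
        · rw [p.2.2.1 l (by simp), r.2.2.1 l (by simp), h0]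
      · rw [p.2.1 s hs, r.2.1 s hs]
    · rintro ⟨x, hx1, hx2⟩
      have hll : -l ≠ l := by omega
      refine ⟨⟨fun s => if s = l then x else if s = -l then L - x else 0, ?_, ?_, ?_, ?_⟩, ?_⟩
      · intro s hs
        simp only [Finset.mem_insert, Finset.mem_singleton, not_or] at hs
        simp [hs]
      · intro s hs
        rcases (by simpa using hs : s = l ∨ s = -l) with rfl | rfl <;> simp [hll]
      · intro s hs
        rcases (by simpa using hs : s = l ∨ s = -l) with rfl | rfl
        · simpa using hx1
        · simp only [hll, if_false, if_true]; omega
      · intro s hs t ht h1 h2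
        simp only [Finset.mem_insert, Finset.mem_singleton] at hs ht
        omega
      · exact Subtype.ext (by simp [F])
  rw [signedCount, Nat.card_congr (Equiv.ofBijective F hF), Nat.card_eq_fintype_card]
  simp only [Fintype.card_ofFinset, Int.card_Icc]
  congr 1
  ring

end Recurrence

/-! ### Sequences as generating functions: comparison of the two counts -/

/-- The shift `(σ f)(n) = f (n - 1)` on two-sided sequences. -/
def seqShift : Module.End ℚ (ℤ → ℚ) := LinearMap.funLeft ℚ ℚ fun n => n - 1

/-- The dilation of a sequence: its terms are placed at the multiples of `a`. -/
def seqDilate (a : ℕ) : Module.End ℚ (ℤ → ℚ) where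
  toFun f n := if (a : ℤ) ∣ n then f (n / a) else 0
  map_add' f g := by funext n; simp only [Pi.add_apply]; split_ifs <;> simp
  map_smul' c f := by funext n; simp only [Pi.smul_apply, RingHom.id_apply]; split_ifs <;> simp

lemma seqDilate_apply (a : ℕ) (f : ℤ → ℚ) (n : ℤ) :
    seqDilate a f n = if (a : ℤ) ∣ n then f (n / a) else 0 := rfl

lemma seqShift_pow_apply (k : ℕ) (f : ℤ → ℚ) (n : ℤ) : (seqShift ^ k) f n = f (n - k) := by
  induction k generalizing n with
  | zero => simp
  | succ k ih =>
    rw [pow_succ', Module.End.mul_apply]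
    change (seqShift ^ k) f (n - 1) = _
    rw [ih]; congr 1; push_cast; ring

lemma aeval_seqShift_apply (P : ℚ[X]) (f : ℤ → ℚ) (n : ℤ) :
    aeval seqShift P f n = ∑ k ∈ Finset.range (P.natDegree + 1), P.coeff k * f (n - k) := by
  rw [aeval_eq_sum_range, LinearMap.sum_apply, Finset.sum_apply]
  simp [seqShift_pow_apply]

lemma aeval_seqShift_X_pow_apply (k : ℕ) (f : ℤ → ℚ) (n : ℤ) :
    aeval seqShift (X ^ k : ℚ[X]) f n = f (n - k) := by
  rw [map_pow, aeval_X, seqShift_pow_apply]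

lemma aeval_seqShift_one_sub_X_pow_apply (k : ℕ) (f : ℤ → ℚ) (n : ℤ) :
    aeval seqShift (1 - X ^ k : ℚ[X]) f n = f n - f (n - k) := by
  rw [map_sub, LinearMap.sub_apply, Pi.sub_apply, aeval_seqShift_X_pow_apply]; simp

lemma aeval_seqShift_mul (P Q : ℚ[X]) (f : ℤ → ℚ) :
    aeval seqShift (P * Q) f = aeval seqShift P (aeval seqShift Q f) := by
  rw [map_mul, Module.End.mul_apply]

lemma aeval_seqShift_comp_X_pow_seqDilate {a : ℕ} (ha : 0 < a) (P : ℚ[X]) (f : ℤ → ℚ) :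
    aeval seqShift (P.comp (X ^ a)) (seqDilate a f) = seqDilate a (aeval seqShift P f) := by
  induction P using Polynomial.induction_on' with
  | add P Q hP hQ => simp only [add_comp, map_add, LinearMap.add_apply, hP, hQ]
  | monomial k c =>
    rw [← C_mul_X_pow_eq_monomial, mul_comp, C_comp, X_pow_comp, aeval_seqShift_mul,
      aeval_seqShift_mul, aeval_C, Module.algebraMap_end_apply, Module.algebraMap_end_apply,
      map_smul]
    congr 1
    funext n
    rw [← pow_mul, aeval_seqShift_X_pow_apply, seqDilate_apply, seqDilate_apply,
      aeval_seqShift_X_pow_apply]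
    have ha' : (a : ℤ) ≠ 0 := by positivity
    have h1 : (n - ((a * k : ℕ) : ℤ)) = n - a * k := by push_cast; ring
    rw [h1]
    have h2 : (a : ℤ) ∣ n - a * k ↔ (a : ℤ) ∣ n := by
      rw [dvd_sub_comm]
      exact (dvd_sub_right (dvd_mul_right _ _))
    simp only [h2]
    split_ifs with h
    · obtain ⟨c, rfl⟩ := h
      rw [← mul_sub, Int.mul_ediv_cancel_left _ ha', Int.mul_ediv_cancel_left _ ha']
    · rfl

lemma aeval_seqShift_of_neg {f : ℤ → ℚ} (hf : ∀ n < 0, f n = 0) (P : ℚ[X]) {n : ℤ} (hn : n < 0) :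
    aeval seqShift P f n = 0 := by
  rw [aeval_seqShift_apply]
  exact Finset.sum_eq_zero fun k _ => by rw [hf _ (by omega), mul_zero]

lemma seqDilate_of_neg {a : ℕ} (ha : 0 < a) {f : ℤ → ℚ} (hf : ∀ n < 0, f n = 0) {n : ℤ}
    (hn : n < 0) : seqDilate a f n = 0 := by
  rw [seqDilate_apply]
  split_ifs
  · exact hf _ (Int.ediv_neg_of_neg_of_pos hn (by positivity))
  · rfl

/-- On sequences supported on the nonnegative integers, `1 - σ ^ k` is injective. -/
lemma eq_of_one_sub_X_pow {k : ℕ} (hk : 0 < k) {f g : ℤ → ℚ} (hf : ∀ n < 0, f n = 0)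
    (hg : ∀ n < 0, g n = 0)
    (h : aeval seqShift (1 - X ^ k : ℚ[X]) f = aeval seqShift (1 - X ^ k : ℚ[X]) g) : f = g := by
  have key : ∀ N : ℕ, ∀ n : ℤ, n < N → f n = g n := by
    intro N
    induction N with
    | zero => intro n hn; rw [hf n (by simpa using hn), hg n (by simpa using hn)]
    | succ N ih =>
      intro n hn
      have h1 := congrFun h n
      rw [aeval_seqShift_one_sub_X_pow_apply, aeval_seqShift_one_sub_X_pow_apply,
        ih (n - k) (by push_cast at hn; omega)] at h1
      linarith
  funext n
  exact key (n + 1).toNat n (by omega)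

lemma phiPoly_mul_one_sub (a : ℕ) : phiPoly a * (1 - X) = 1 - X ^ a := by
  rw [mul_comm, phiPoly, mul_neg_geom_sum]

/-- The number of configurations, as a sequence in the length. -/
def countSeq (e a : ℕ) (T : Finset ℤ) (u : ℤ) : ℤ → ℚ := fun L => signedCount e a T u L

lemma countSeq_of_neg {e a : ℕ} (ha : 0 < a) {T : Finset ℤ} (hT : IsSignedSet T)
    (hne : T.Nonempty) {u n : ℤ} (hn : n < 0) : countSeq e a T u n = 0 := by
  rw [countSeq, signedCount_of_neg (by positivity) (by exact_mod_cast ha) hT hne hn, Nat.cast_zero]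

lemma one_sub_X_sq_countSeq {e a : ℕ} (ha : 0 < a) {T : Finset ℤ} (hT : IsSignedSet T)
    (hc : 2 < T.card) (u : ℤ) :
    aeval seqShift (1 - X ^ 2 : ℚ[X]) (countSeq e a T u) = ∑ v ∈ T,
      aeval seqShift (X ^ (2 * (e + a * if u < v then 1 else 0)) : ℚ[X])
        (countSeq e a (erasePair T v) v) := by
  funext L
  rw [aeval_seqShift_one_sub_X_pow_apply, Finset.sum_apply]
  simp only [aeval_seqShift_X_pow_apply, countSeq]
  rw [signedCount_sub (L := L) (by positivity) (by exact_mod_cast ha) hT hc]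
  push_cast
  rw [add_sub_cancel_left]
  refine Finset.sum_congr rfl fun v _ => ?_
  simp

/-- The sequence `0, …, 0, 1, 2, 3, …` with first nonzero term at `c`. -/
def rampSeq (c : ℤ) : ℤ → ℚ := fun n => ((n + 1 - c).toNat : ℚ)

lemma one_sub_X_sq_rampSeq (c : ℤ) :
    aeval seqShift ((1 - X ^ 1) * (1 - X ^ 1) : ℚ[X]) (rampSeq c) = Pi.single c 1 := by
  funext n
  rw [aeval_seqShift_mul]
  simp only [aeval_seqShift_one_sub_X_pow_apply, rampSeq, Pi.single_apply]
  rcases lt_trichotomy n c with h | rfl | h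
  · rw [if_neg h.ne, Int.toNat_of_nonpos (by omega), Int.toNat_of_nonpos (by push_cast; omega),
      Int.toNat_of_nonpos (by push_cast; omega)]
    simp
  · simp
  · obtain ⟨k, rfl⟩ : ∃ k : ℕ, n = c + 1 + k := ⟨(n - c - 1).toNat, by omega⟩
    rw [if_neg h.ne', show c + 1 + (k : ℤ) + 1 - c = ((k + 2 : ℕ) : ℤ) by push_cast; ring,
      show c + 1 + (k : ℤ) - ((1 : ℕ) : ℤ) + 1 - c = ((k + 1 : ℕ) : ℤ) by push_cast; ring,
      show c + 1 + (k : ℤ) - ((1 : ℕ) : ℤ) - ((1 : ℕ) : ℤ) + 1 - c = (k : ℤ) by push_cast; ring]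
    simp only [Int.toNat_natCast]
    push_cast
    ring

lemma rampSeq_of_neg {c : ℤ} (hc : 0 ≤ c) {n : ℤ} (hn : n < 0) : rampSeq c n = 0 := by
  rw [rampSeq, Int.toNat_of_nonpos (by omega), Nat.cast_zero]

/-- In generating functions a ramp is `y^c / (1 - y)²`, and `(1 - y^a)² = φ_a(y)² (1 - y)²`. -/
lemma rampSeq_dilate {a : ℕ} (ha : 0 < a) (k : ℕ) :
    rampSeq (a * k + 2) = aeval seqShift ((X * phiPoly a) ^ 2) (seqDilate a (rampSeq k)) := by
  have hD : ∀ n < 0, seqDilate a (rampSeq k) n = 0 :=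
    fun n hn => seqDilate_of_neg ha (fun m hm => rampSeq_of_neg (by positivity) hm) hn
  have hl : ∀ n < 0, rampSeq (a * k + 2) n = 0 := fun n hn => rampSeq_of_neg (by positivity) hn
  refine eq_of_one_sub_X_pow one_pos hl (fun n hn => aeval_seqShift_of_neg hD _ hn) ?_
  refine eq_of_one_sub_X_pow one_pos (fun n hn => aeval_seqShift_of_neg hl _ hn)
    (fun n hn => aeval_seqShift_of_neg (fun m hm => aeval_seqShift_of_neg hD _ hm) _ hn) ?_
  rw [← aeval_seqShift_mul, ← aeval_seqShift_mul, ← aeval_seqShift_mul, one_sub_X_sq_rampSeq]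
  have h1 : ((1 - X ^ 1) * ((1 - X ^ 1) * (X * phiPoly a) ^ 2) : ℚ[X]) =
      X ^ 2 * ((1 - X ^ 1) * (1 - X ^ 1) : ℚ[X]).comp (X ^ a) := by
    simp only [pow_one, mul_comp, sub_comp, one_comp, X_comp]
    rw [← phiPoly_mul_one_sub]; ring
  rw [mul_assoc, h1, aeval_seqShift_mul, aeval_seqShift_comp_X_pow_seqDilate ha,
    one_sub_X_sq_rampSeq]
  funext n
  rw [aeval_seqShift_X_pow_apply, seqDilate_apply]
  simp only [Pi.single_apply]
  have ha' : (a : ℤ) ≠ 0 := by positivity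
  by_cases h : n = a * k + 2
  · subst h
    simp [Int.mul_ediv_cancel_left _ ha']
  · rw [if_neg h]
    split_ifs with h2 h3
    · exfalso
      obtain ⟨d, hd⟩ := h2
      rw [hd, Int.mul_ediv_cancel_left _ ha'] at h3
      subst h3
      push_cast at hd
      omega
    · rfl
    · rfl

lemma countSeq_pair (e a : ℕ) {l : ℤ} (hl : l ≠ 0) (u : ℤ) :
    countSeq e a {l, -l} u =
      rampSeq (a * (((if u < l then 1 else 0) + (if u < -l then 1 else 0) : ℕ)) + 2 * e) := by
  funext n
  rw [countSeq, signedCount_pair hl, rampSeq]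
  congr 2
  split_ifs <;> push_cast <;> ring

lemma IsSignedSet.eq_pair {T : Finset ℤ} (hT : IsSignedSet T) (hc : T.card = 2) :
    ∃ l : ℤ, l ≠ 0 ∧ T = {l, -l} := by
  obtain ⟨l, hl⟩ : T.Nonempty := Finset.card_pos.1 (by omega)
  have h0 : l ≠ 0 := fun h => hT.1 (h ▸ hl)
  refine ⟨l, h0, (Finset.eq_of_subset_of_card_le ?_ ?_).symm⟩
  · intro s hs
    rcases (by simpa using hs : s = l ∨ s = -l) with rfl | rfl
    · exact hl
    · exact hT.2 l hl
  · rw [hc, Finset.card_pair (by omega)]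

/-- Division of all gaps by `a`: the configurations with parameters `(1, a)` are counted by those
with parameters `(0, 1)`. -/
lemma countSeq_eq_aeval_seqDilate {a : ℕ} (ha : 0 < a) (n : ℕ) :
    ∀ (T : Finset ℤ) (u : ℤ), IsSignedSet T → T.card = 2 * (n + 1) →
    countSeq 1 a T u = aeval seqShift
      ((X ^ 2 * (phiPoly a).comp (X ^ 2)) ^ n * (X * phiPoly a) ^ 2)
        (seqDilate a (countSeq 0 1 T u)) := by
  induction n with
  | zero =>
    intro T u hT hc
    obtain ⟨l, hl, rfl⟩ := hT.eq_pair (by omega)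
    rw [countSeq_pair _ _ hl, countSeq_pair _ _ hl, pow_zero, one_mul]
    simpa using rampSeq_dilate ha ((if u < l then 1 else 0) + (if u < -l then 1 else 0))
  | succ n ih =>
    intro T u hT hc
    have hne : T.Nonempty := Finset.card_pos.1 (by omega)
    refine eq_of_one_sub_X_pow two_pos (fun n hn => countSeq_of_neg ha hT hne hn)
      (fun n hn => aeval_seqShift_of_neg
        (fun m hm => seqDilate_of_neg ha (fun k hk => countSeq_of_neg one_pos hT hne hk) hm) _ hn) ?_
    -- Since `(1 - y²) φ_a(y²) = 1 - y^{2a}`, one factor turns the recurrence step of the `(1, a)`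
    -- count into the dilated step of the `(0, 1)` count.
    have h1 : ((1 - X ^ 2) * ((X ^ 2 * (phiPoly a).comp (X ^ 2)) ^ (n + 1) *
        (X * phiPoly a) ^ 2) : ℚ[X]) = X ^ 2 * ((X ^ 2 * (phiPoly a).comp (X ^ 2)) ^ n *
        (X * phiPoly a) ^ 2) * (1 - X ^ 2 : ℚ[X]).comp (X ^ a) := by
      have h2 := congrArg (fun P : ℚ[X] => P.comp (X ^ 2)) (phiPoly_mul_one_sub a)
      simp only [mul_comp, sub_comp, one_comp, X_comp, X_pow_comp] at h2 ⊢
      rw [← pow_mul, mul_comm a 2, pow_mul, ← h2]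
      ring
    rw [one_sub_X_sq_countSeq ha hT (by omega), ← aeval_seqShift_mul, h1, aeval_seqShift_mul,
      aeval_seqShift_comp_X_pow_seqDilate ha, one_sub_X_sq_countSeq one_pos hT (by omega),
      map_sum, map_sum]
    refine Finset.sum_congr rfl fun v hv => ?_
    have hcv := hT.card_erasePair hv
    rw [ih _ _ (hT.erasePair v) (by omega), ← aeval_seqShift_comp_X_pow_seqDilate ha,
      ← aeval_seqShift_mul, ← aeval_seqShift_mul, X_pow_comp]
    congr 2
    ring

/-! ### Removing residue-class restrictions -/

lemma shiftOp_pow_eval (k : ℕ) (f : ℚ[X]) (x : ℚ) :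
    ((shiftOp ^ k) f).eval x = f.eval (x - k) := by
  induction k generalizing x with
  | zero => simp
  | succ k ih =>
    rw [pow_succ', Module.End.mul_apply, shiftOp, taylor_eval, ← shiftOp, ih]
    congr 1; push_cast; ring

/-- Evaluation at integers intertwines the two shifts. -/
lemma aeval_shiftOp_eval (P f : ℚ[X]) (n : ℤ) :
    (aeval shiftOp P f).eval (n : ℚ) = aeval seqShift P (fun k : ℤ => f.eval (k : ℚ)) n := by
  rw [aeval_seqShift_apply, aeval_eq_sum_range, LinearMap.sum_apply, eval_finsetSum]
  simp [shiftOp_pow_eval]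

lemma degree_taylor_sub_lt {f : ℚ[X]} {d : ℕ} (hf : f.degree < (d + 1 : ℕ)) (r : ℚ) :
    (taylor r f - f).degree < d := by
  by_cases h0 : f = 0
  · subst h0; simp
  · refine (degree_sub_lt_left (degree_taylor f r) ?_ (leadingCoeff_taylor _ _)).trans_le ?_
    · simpa using h0
    · rw [degree_taylor, degree_eq_natDegree h0]
      rw [degree_eq_natDegree h0] at hf
      exact_mod_cast Nat.le_of_lt_succ (by exact_mod_cast hf)

lemma sum_range_ite_dvd_sub {b : ℕ} (hb : 0 < b) (t : ℤ) :
    ∑ i ∈ Finset.range b, (if (b : ℤ) ∣ t - i then (b : ℚ) else 0) = b := by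
  have hb' : (b : ℤ) ≠ 0 := by positivity
  have h1 := Int.emod_nonneg t hb'
  have h2 := Int.emod_lt_of_pos t (by positivity : (0 : ℤ) < b)
  rw [Finset.sum_eq_single (t % b).toNat]
  · rw [if_pos]
    rw [Int.toNat_of_nonneg h1]
    exact Int.dvd_self_sub_emod
  · intro i hi hne
    rw [if_neg]
    intro h
    refine hne ?_
    have h4 : t % b = i % b :=
      Int.emod_eq_emod_iff_emod_sub_eq_zero.2 (Int.emod_eq_zero_of_dvd h)
    rw [Int.emod_eq_of_lt (a := (i : ℤ)) (by positivity)
      (by exact_mod_cast Finset.mem_range.1 hi)] at h4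
    omega
  · intro h
    exact absurd (Finset.mem_range.2 (by omega)) h

/-- The function `b·[cb ∣ n - r] - [c ∣ n - r]` of zero mean along progressions of step `c`. -/
def residueDefect (c b : ℕ) (r n : ℤ) : ℚ :=
  (if ((c * b : ℕ) : ℤ) ∣ n - r then (b : ℚ) else 0) - if (c : ℤ) ∣ n - r then 1 else 0

/-- Among `b` consecutive terms of a class modulo `c`, exactly one lies in a given subclass modulo
`cb`, where the weight is `b`. -/
lemma sum_residueDefect {c b : ℕ} (hc : 0 < c) (hb : 0 < b) (r n : ℤ) :
    ∑ i ∈ Finset.range b, residueDefect c b r (n - c * i) = 0 := by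
  have hc' : (c : ℤ) ≠ 0 := by positivity
  simp only [residueDefect]
  by_cases h : (c : ℤ) ∣ n - r
  · obtain ⟨t, ht⟩ := h
    have h1 : ∀ i : ℕ, n - c * i - r = c * (t - i) := fun i => by rw [mul_sub, ← ht]; ring
    simp only [h1, Nat.cast_mul, Int.mul_dvd_mul_iff_left hc', dvd_mul_right, if_true,
      Finset.sum_sub_distrib, sum_range_ite_dvd_sub hb]
    simp
  · refine Finset.sum_eq_zero fun i _ => ?_
    have h1 : ¬ (c : ℤ) ∣ n - c * i - r := fun h2 => h (by
      have := dvd_add h2 (dvd_mul_right (c : ℤ) i)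
      rwa [show n - c * i - r + c * i = n - r by ring] at this)
    have h2 : ¬ ((c * b : ℕ) : ℤ) ∣ n - c * i - r := fun h2 => h1 (by
      push_cast at h2; exact (dvd_mul_right _ _).trans h2)
    rw [if_neg h1, if_neg h2, sub_zero]

lemma aeval_seqShift_phiPoly_comp_apply (c b : ℕ) (f : ℤ → ℚ) (n : ℤ) :
    aeval seqShift ((phiPoly b).comp (X ^ c)) f n =
      ∑ i ∈ Finset.range b, f (n - c * i) := by
  rw [phiPoly, Polynomial.sum_comp, map_sum, LinearMap.sum_apply, Finset.sum_apply]
  refine Finset.sum_congr rfl fun i _ => ?_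
  rw [X_pow_comp, ← pow_mul, aeval_seqShift_X_pow_apply]
  push_cast; rfl

/-- `φ_b(σ^c)^d` does not distinguish the residue classes modulo `cb` inside a class modulo `c`,
on polynomials of degree less than `d`. -/
lemma phiPoly_pow_residueDefect {c b : ℕ} (hc : 0 < c) (hb : 0 < b) (d : ℕ) :
    ∀ (f : ℚ[X]) (r : ℤ), f.degree < d →
      aeval seqShift ((phiPoly b).comp (X ^ c) ^ d)
        (fun n : ℤ => residueDefect c b r n * f.eval (n : ℚ)) = 0 := by
  induction d with
  | zero =>
    intro f r hf
    have : f = 0 := by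
      rw [← degree_eq_bot]
      exact Nat.WithBot.lt_zero_iff.1 (by simpa using hf)
    subst this
    have : (fun n : ℤ => residueDefect c b r n * (0 : ℚ[X]).eval (n : ℚ)) = 0 := by
      funext n; simp
    rw [this, map_zero]
  | succ d ih =>
    intro f r hf
    have h1 : aeval seqShift ((phiPoly b).comp (X ^ c))
        (fun n : ℤ => residueDefect c b r n * f.eval (n : ℚ)) =
        ∑ i ∈ Finset.range b, fun n : ℤ => residueDefect c b (r + c * i) n *
          (taylor (-(c * i : ℚ)) f - f).eval (n : ℚ) := by
      funext n
      rw [aeval_seqShift_phiPoly_comp_apply, Finset.sum_apply]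
      -- By zero mean, `f(n)` may be subtracted from every `f(n - ci)`; the differences have smaller
      -- degree, which drives the induction.
      have h2 : ∑ i ∈ Finset.range b, residueDefect c b r (n - c * i) * f.eval (n : ℚ) = 0 := by
        rw [← Finset.sum_mul, sum_residueDefect hc hb, zero_mul]
      rw [← sub_zero (∑ i ∈ Finset.range b, _), ← h2, ← Finset.sum_sub_distrib]
      refine Finset.sum_congr rfl fun i _ => ?_
      have h3 : residueDefect c b (r + c * i) n = residueDefect c b r (n - c * i) := by
        simp only [residueDefect]
        rw [show n - (r + c * i) = n - c * i - r by ring]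
      rw [h3, eval_sub, taylor_eval, ← mul_sub]
      push_cast
      rw [sub_eq_add_neg (n : ℚ)]
    rw [pow_succ, aeval_seqShift_mul, h1, map_sum]
    exact Finset.sum_eq_zero fun i _ => ih _ _ (degree_taylor_sub_lt hf _)

lemma aeval_seqShift_residue_class {c b : ℕ} (hc : 0 < c) (hb : 0 < b) {P : ℚ[X]} {m : ℕ}
    (hP : (phiPoly b).comp (X ^ c) ^ (m + 1) ∣ P) (n : ℤ) :
    b * aeval seqShift P (fun k : ℤ => if ((c * b : ℕ) : ℤ) ∣ k then (k : ℚ) ^ m else 0) n =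
      aeval seqShift P (fun k : ℤ => if (c : ℤ) ∣ k then (k : ℚ) ^ m else 0) n := by
  obtain ⟨Q, rfl⟩ := hP
  have h := phiPoly_pow_residueDefect hc hb (m + 1) (X ^ m) 0
    (by rw [degree_X_pow]; exact_mod_cast Nat.lt_succ_self m)
  have h1 : (fun k : ℤ => residueDefect c b 0 k * (X ^ m : ℚ[X]).eval (k : ℚ)) =
      (b : ℚ) • (fun k : ℤ => if ((c * b : ℕ) : ℤ) ∣ k then (k : ℚ) ^ m else 0) -
        fun k : ℤ => if (c : ℤ) ∣ k then (k : ℚ) ^ m else 0 := by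
    funext k
    simp only [residueDefect, sub_zero, eval_pow, eval_X, Pi.sub_apply, Pi.smul_apply, smul_eq_mul]
    split_ifs <;> ring
  have h2 := congrArg (fun f => aeval seqShift Q f n) h
  simp only [h1, ← aeval_seqShift_mul, map_sub, map_smul, map_zero, Pi.sub_apply, Pi.smul_apply,
    smul_eq_mul, Pi.zero_apply, mul_comm Q] at h2
  linarith

/-- Polynomials in `σ²` commute with the restriction to even integers. -/
lemma aeval_seqShift_comp_X_sq_even (G : ℚ[X]) (f : ℤ → ℚ) :
    aeval seqShift (G.comp (X ^ 2)) (fun k : ℤ => if (2 : ℤ) ∣ k then f k else 0) =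
      fun k : ℤ => if (2 : ℤ) ∣ k then aeval seqShift (G.comp (X ^ 2)) f k else 0 := by
  induction G using Polynomial.induction_on' with
  | add P Q hP hQ =>
    simp only [add_comp, map_add, LinearMap.add_apply, hP, hQ]
    funext k
    simp only [Pi.add_apply]
    split_ifs <;> simp
  | monomial k c =>
    funext n
    rw [← C_mul_X_pow_eq_monomial, mul_comp, C_comp, X_pow_comp, ← pow_mul, aeval_seqShift_mul,
      aeval_seqShift_mul, aeval_C, Module.algebraMap_end_apply, Module.algebraMap_end_apply]
    simp only [Pi.smul_apply, aeval_seqShift_X_pow_apply]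
    have : (2 : ℤ) ∣ n - ((2 * k : ℕ) : ℤ) ↔ (2 : ℤ) ∣ n := by push_cast; omega
    simp only [this]
    split_ifs <;> simp

lemma phiPoly_comp_X_pow_mul (c b : ℕ) : (phiPoly b).comp (X ^ c) * (1 - X ^ c) =
    (1 - X ^ (c * b) : ℚ[X]) := by
  have h := congrArg (fun P : ℚ[X] => P.comp (X ^ c)) (phiPoly_mul_one_sub b)
  simpa only [mul_comp, sub_comp, one_comp, X_comp, X_pow_comp, ← pow_mul] using h

lemma one_sub_X_pow_ne_zero {c : ℕ} (hc : 0 < c) : (1 - X ^ c : ℚ[X]) ≠ 0 := by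
  intro h
  have := congrArg (eval 0) h
  simp [hc.ne'] at this

/-- The quotient is `(1 + y^a) / (1 + y)`, a polynomial because `a` is odd. -/
lemma phiPoly_dvd_comp_X_sq {a : ℕ} (ha : Odd a) : phiPoly a ∣ (phiPoly a).comp (X ^ 2) := by
  obtain ⟨Q, hQ⟩ : (1 + X : ℚ[X]) ∣ 1 + X ^ a := by
    simpa using ha.add_dvd_pow_add_pow (1 : ℚ[X]) X
  refine ⟨Q, mul_right_cancel₀ (one_sub_X_pow_ne_zero two_pos) ?_⟩
  rw [phiPoly_comp_X_pow_mul]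
  have h := phiPoly_mul_one_sub a
  calc (1 - X ^ (2 * a) : ℚ[X]) = (1 - X ^ a) * (1 + X ^ a) := by ring
    _ = phiPoly a * (1 - X) * ((1 + X) * Q) := by rw [h, hQ]
    _ = _ := by ring

lemma phiPoly_two_mul_comp_X_sq (b : ℕ) :
    (phiPoly (2 * b)).comp (X ^ 2) = (phiPoly b).comp (X ^ 2) * (1 + X ^ (2 * b)) := by
  refine mul_right_cancel₀ (one_sub_X_pow_ne_zero two_pos) ?_
  rw [phiPoly_comp_X_pow_mul, mul_right_comm, phiPoly_comp_X_pow_mul]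
  ring

lemma phiPoly_two_mul (b : ℕ) :
    phiPoly (2 * b) = (phiPoly b).comp (X ^ 2) * (1 + X) := by
  refine mul_right_cancel₀ (one_sub_X_pow_ne_zero one_pos) ?_
  rw [pow_one, phiPoly_mul_one_sub, ← phiPoly_comp_X_pow_mul]
  ring

/-! ### The complement modulo `q` as a set of configurations -/

/-- The signed labels `±1, …, ±m`. -/
def signedLabels (m : ℕ) : Finset ℤ := (Finset.Icc (-(m : ℤ)) m).erase 0

lemma mem_signedLabels {m : ℕ} {s : ℤ} : s ∈ signedLabels m ↔ s ≠ 0 ∧ -(m : ℤ) ≤ s ∧ s ≤ m := by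
  simp [signedLabels]

lemma isSignedSet_signedLabels (m : ℕ) : IsSignedSet (signedLabels m) := by
  refine ⟨by simp [signedLabels], fun s hs => ?_⟩
  rw [mem_signedLabels] at *
  omega

lemma card_signedLabels (m : ℕ) : (signedLabels m).card = 2 * m := by
  rw [signedLabels, Finset.card_erase_of_mem (by simp), Int.card_Icc]
  omega

/-- The label of the `i`-th coordinate; the order of the labels is opposite to that of the
coordinates. -/
def coordLabel {m : ℕ} (i : Fin m) : ℤ := m - (i : ℕ)

lemma coordLabel_pos {m : ℕ} (i : Fin m) : 0 < coordLabel i := by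
  have := i.2; unfold coordLabel; omega

lemma coordLabel_lt_iff {m : ℕ} {i j : Fin m} : coordLabel i < coordLabel j ↔ j < i := by
  unfold coordLabel; rw [Fin.lt_def]; omega

lemma coordLabel_injective {m : ℕ} : Function.Injective (coordLabel (m := m)) := by
  intro i j h; unfold coordLabel at h; exact Fin.ext (by omega)

lemma coordLabel_mem {m : ℕ} (i : Fin m) : coordLabel i ∈ signedLabels m := by
  have := i.2; rw [mem_signedLabels]; unfold coordLabel; omega

lemma exists_coordLabel {m : ℕ} {s : ℤ} (hs : s ∈ signedLabels m) :
    ∃ i : Fin m, s = coordLabel i ∨ s = -coordLabel i := by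
  rw [mem_signedLabels] at hs
  refine ⟨⟨m - s.natAbs, by omega⟩, ?_⟩
  simp only [coordLabel]
  omega

open Classical in
/-- The symmetric placement of the labels `±1, …, ±m` with given coordinates. -/
def reflectConfig (m : ℕ) (L : ℤ) (x : Fin m → ℤ) (s : ℤ) : ℤ :=
  if h : ∃ i, coordLabel i = s then x h.choose
  else if h : ∃ i, coordLabel i = -s then L - x h.choose else 0

section Reflect

variable {m : ℕ} {L : ℤ} {x : Fin m → ℤ}

lemma reflectConfig_coordLabel (i : Fin m) : reflectConfig m L x (coordLabel i) = x i := by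
  have h : ∃ j : Fin m, coordLabel j = coordLabel i := ⟨i, rfl⟩
  rw [reflectConfig, dif_pos h, coordLabel_injective h.choose_spec]

lemma reflectConfig_neg_coordLabel (i : Fin m) :
    reflectConfig m L x (-coordLabel i) = L - x i := by
  have h : ∃ j : Fin m, coordLabel j = - -coordLabel i := ⟨i, (neg_neg _).symm⟩
  have h' : ¬ ∃ j : Fin m, coordLabel j = -coordLabel i := by
    rintro ⟨j, hj⟩
    have := coordLabel_pos i
    have := coordLabel_pos j
    omega
  rw [reflectConfig, dif_neg h', dif_pos h,
    coordLabel_injective (h.choose_spec.trans (neg_neg _))]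

lemma reflectConfig_of_notMem {s : ℤ} (hs : s ∉ signedLabels m) : reflectConfig m L x s = 0 := by
  rw [reflectConfig, dif_neg, dif_neg]
  · rintro ⟨i, hi⟩
    have := (isSignedSet_signedLabels m).2 _ (coordLabel_mem i)
    rw [hi, neg_neg] at this
    exact hs this
  · rintro ⟨i, hi⟩
    exact hs (hi ▸ coordLabel_mem i)

lemma reflectConfig_neg {s : ℤ} (hs : s ∈ signedLabels m) :
    reflectConfig m L x (-s) = L - reflectConfig m L x s := by
  obtain ⟨i, rfl | rfl⟩ := exists_coordLabel hs
  · rw [reflectConfig_coordLabel, reflectConfig_neg_coordLabel]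
  · rw [neg_neg, reflectConfig_coordLabel, reflectConfig_neg_coordLabel]; ring

lemma signedCount_eq_card (e a : ℤ) (m : ℕ) (u L : ℤ) :
    signedCount e a (signedLabels m) u L =
      Nat.card {x : Fin m → ℤ // reflectConfig m L x ∈ signedConfig e a (signedLabels m) u L} := by
  refine (Nat.card_congr (Equiv.ofBijective
    (fun x => ⟨reflectConfig m L x.1, x.2⟩) ⟨fun x y h => ?_, fun p => ?_⟩)).symm
  · refine Subtype.ext (funext fun i => ?_)
    have := congrFun (congrArg Subtype.val h) (coordLabel i)
    simpa only [reflectConfig_coordLabel] using this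
  · have h : reflectConfig m L (fun i => p.1 (coordLabel i)) = p.1 := by
      funext s
      by_cases hs : s ∈ signedLabels m
      · obtain ⟨i, rfl | rfl⟩ := exists_coordLabel hs
        · rw [reflectConfig_coordLabel]
        · rw [reflectConfig_neg_coordLabel, p.2.2.1 _ (coordLabel_mem i)]
      · rw [reflectConfig_of_notMem hs, p.2.1 s hs]
    exact ⟨⟨fun i => p.1 (coordLabel i), by rw [h]; exact p.2⟩, Subtype.ext h⟩

/-- For parameters `(0, 1)` the pair condition is automatic, as distinct integers differ by at least
1; only the two ends constrain. -/
lemma reflectConfig_mem_unit_iff :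
    reflectConfig m L x ∈ signedConfig 0 1 (signedLabels m) 0 L ↔ ∀ i, x i ∈ Set.Icc 1 L := by
  constructor
  · intro h i
    have h1 := h.2.2.1 _ (coordLabel_mem i)
    have h2 := h.2.2.1 _ ((isSignedSet_signedLabels m).2 _ (coordLabel_mem i))
    have h3 := coordLabel_pos i
    rw [reflectConfig_coordLabel, if_pos h3] at h1
    rw [reflectConfig_neg_coordLabel, if_neg (by omega)] at h2
    exact ⟨by omega, by omega⟩
  · intro h
    refine ⟨fun s hs => reflectConfig_of_notMem hs, fun s hs => reflectConfig_neg hs,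
      fun s hs => ?_, fun s _ t _ _ _ _ => ⟨by omega, by omega⟩⟩
    obtain ⟨i, rfl | rfl⟩ := exists_coordLabel hs
    · have h3 := coordLabel_pos i
      rw [reflectConfig_coordLabel, if_pos h3]
      exact (h i).1
    · have h3 := coordLabel_pos i
      rw [reflectConfig_neg_coordLabel, if_neg (by omega)]
      have := (h i).2
      omega

lemma signedCount_unit (m : ℕ) {L : ℤ} :
    signedCount 0 1 (signedLabels m) 0 L = L.toNat ^ m := by
  rw [signedCount_eq_card]
  simp only [reflectConfig_mem_unit_iff]
  rw [Nat.card_congr (Equiv.subtypePiEquivPi (p := fun _ y => y ∈ Set.Icc 1 L)), Nat.card_pi]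
  have h : Nat.card (Set.Icc 1 L) = L.toNat := by
    rw [Nat.card_eq_fintype_card]
    simp only [Fintype.card_ofFinset, Int.card_Icc]
    congr 1
    ring
  rw [Finset.prod_const, Finset.card_univ, Fintype.card_fin]
  exact congrArg (· ^ m) h

end Reflect

/-- The congruences avoided by the points of the complement. -/
lemma mem_complementMod_bHat_iff {m a q : ℕ} {z : Fin m → ZMod q} :
    z ∈ complementMod (bHatMatrix m a) (bHatConst m a) q ↔
      (∀ i, ∀ k ≤ a, z i ≠ (k : ZMod q)) ∧ (∀ i j, i < j → ∀ k ≤ a, z i - z j ≠ (k : ZMod q)) ∧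
      ∀ i j, i < j → ∀ k ≤ a, z i + z j ≠ (k : ZMod q) := by
  simp only [complementMod, hyperplaneMod, Set.mem_sdiff, Set.mem_univ, true_and, Set.mem_iUnion,
    Set.mem_ofPred_eq, not_exists, bHatMatrix, Matrix.of_apply]
  constructor
  · intro h
    refine ⟨fun i k hk => ?_, fun i j hij k hk => ?_, fun i j hij k hk => ?_⟩
    · simpa [BHatIndex.coeff, bHatConst, Pi.single_apply] using
        h (.coord i ⟨k, Nat.lt_succ_of_le hk⟩)
    · simpa [BHatIndex.coeff, bHatConst, Pi.single_apply, mul_sub, Finset.sum_sub_distrib] using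
        h (.diff i j hij ⟨k, Nat.lt_succ_of_le hk⟩)
    · simpa [BHatIndex.coeff, bHatConst, Pi.single_apply, mul_add, Finset.sum_add_distrib] using
        h (.sum i j hij ⟨k, Nat.lt_succ_of_le hk⟩)
  · rintro ⟨h1, h2, h3⟩ (⟨i, k⟩ | ⟨i, j, hij, k⟩ | ⟨i, j, hij, k⟩)
    · simpa [BHatIndex.coeff, bHatConst, Pi.single_apply] using h1 i k (Nat.le_of_lt_succ k.2)
    · simpa [BHatIndex.coeff, bHatConst, Pi.single_apply, mul_sub, Finset.sum_sub_distrib] using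
        h2 i j hij k (Nat.le_of_lt_succ k.2)
    · simpa [BHatIndex.coeff, bHatConst, Pi.single_apply, mul_add, Finset.sum_add_distrib] using
        h3 i j hij k (Nat.le_of_lt_succ k.2)

lemma intCast_ne_natCast_iff {q : ℕ} (y : ℤ) (k : ℕ) :
    (y : ZMod q) ≠ (k : ZMod q) ↔ ¬ (q : ℤ) ∣ y - k := by
  rw [← ZMod.intCast_zmod_eq_zero_iff_dvd, Int.cast_sub, Int.cast_natCast, sub_eq_zero]

/-- In a configuration on a segment of length `q`, the distance from a label to a larger one is not
congruent to `0, …, a` modulo `q`. -/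
lemma signedConfig_not_dvd {m a q : ℕ} {p : ℤ → ℤ}
    (hp : p ∈ signedConfig 1 a (signedLabels m) 0 q) {s t : ℤ} (hs : s ∈ signedLabels m)
    (ht : t ∈ signedLabels m) (hst : s < t) (hst' : s ≠ -t) {k : ℕ} (hk : k ≤ a) :
    ¬ (q : ℤ) ∣ p t - p s - k := by
  rintro ⟨c, hc⟩
  have hneg := (isSignedSet_signedLabels m).2
  have hs1 := hp.2.2.1 s hs
  have hs2 := hp.2.2.1 (-s) (hneg s hs)
  have hs3 := hp.2.1 s hs
  have ht1 := hp.2.2.1 t ht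
  have ht2 := hp.2.2.1 (-t) (hneg t ht)
  have ht3 := hp.2.1 t ht
  have hs4 : 1 ≤ p s ∧ 1 ≤ p (-s) := by split_ifs at hs1 hs2 <;> omega
  have ht4 : 1 ≤ p t ∧ 1 ≤ p (-t) := by split_ifs at ht1 ht2 <;> omega
  rcases lt_trichotomy c 0 with h | h | h
  -- Wrap-around: `t` would be near the left end and `s` near the right end, but `t > 0` or `-s >
  -- 0`, so one of those ends keeps its distance `1 + a`.
  · have h1 : (q : ℤ) * c ≤ -q := by nlinarith
    by_cases h2 : 0 < t
    · rw [if_pos h2] at ht1; omega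
    · rw [if_pos (show 0 < -s by omega)] at hs2; omega
  · subst h
    have h1 := hp.2.2.2 s hs t ht hst.ne hst' (by omega)
    have h2 := h1.2 hst (by omega)
    omega
  · have h1 : (q : ℤ) ≤ q * c := by nlinarith
    omega

/-- Modulo `q`, a difference of two labels of equal sign gives `x_i - x_j`, and of opposite sign
`x_i + x_j`. Because `coordLabel` reverses the order, `i < j` matches a step from a smaller label to
a larger one. -/
lemma reflectConfig_mem_iff {m a q : ℕ} {x : Fin m → ℤ} (hx : ∀ i, 0 ≤ x i ∧ x i < q) :
    reflectConfig m q x ∈ signedConfig 1 a (signedLabels m) 0 q ↔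
      (fun i => (x i : ZMod q)) ∈ complementMod (bHatMatrix m a) (bHatConst m a) q := by
  have hneg := (isSignedSet_signedLabels m).2
  rw [mem_complementMod_bHat_iff]
  simp only [← Int.cast_sub, ← Int.cast_add, intCast_ne_natCast_iff]
  constructor
  · intro hp
    refine ⟨fun i k hk h => ?_, fun i j hij k hk h => ?_, fun i j hij k hk h => ?_⟩
    · have h1 := hp.2.2.1 _ (coordLabel_mem i)
      rw [reflectConfig_coordLabel, if_pos (coordLabel_pos i)] at h1
      have h2 := Int.le_of_dvd (by omega) h
      have := (hx i).2
      omega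
    · have hi := coordLabel_pos i
      have hj := coordLabel_pos j
      refine signedConfig_not_dvd hp (coordLabel_mem j) (coordLabel_mem i)
        (coordLabel_lt_iff.2 hij) (by omega) hk ?_
      rwa [reflectConfig_coordLabel, reflectConfig_coordLabel]
    · have hi := coordLabel_pos i
      have hj := coordLabel_pos j
      have hlt := coordLabel_lt_iff.2 hij
      refine signedConfig_not_dvd hp (hneg _ (coordLabel_mem j)) (coordLabel_mem i)
        (by omega) (by omega) hk ?_
      rw [reflectConfig_coordLabel, reflectConfig_neg_coordLabel]
      have := dvd_sub h (dvd_refl (q : ℤ))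
      rwa [show x i + x j - k - q = x i - (q - x j) - k by ring] at this
  · rintro ⟨h1, h2, h3⟩
    have h3' : ∀ i j, i ≠ j → ∀ k ≤ a, ¬ (q : ℤ) ∣ x i + x j - k := by
      intro i j hij k hk
      rcases lt_or_gt_of_ne hij with h | h
      · exact h3 i j h k hk
      · rw [add_comm]; exact h3 j i h k hk
    have core : ∀ s ∈ signedLabels m, ∀ t ∈ signedLabels m, s < t → s ≠ -t → ∀ k : ℕ, k ≤ a →
        ¬ (q : ℤ) ∣ reflectConfig m q x t - reflectConfig m q x s - k := by
      intro s hs t ht hst hst' k hk h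
      obtain ⟨i, hi⟩ := exists_coordLabel hs
      obtain ⟨j, hj⟩ := exists_coordLabel ht
      have hi0 := coordLabel_pos i
      have hj0 := coordLabel_pos j
      rcases hi with rfl | rfl <;> rcases hj with rfl | rfl
      · rw [reflectConfig_coordLabel, reflectConfig_coordLabel] at h
        exact h2 j i (coordLabel_lt_iff.1 hst) k hk h
      · omega
      · rw [reflectConfig_coordLabel, reflectConfig_neg_coordLabel] at h
        refine h3' j i (fun hij => hst' (by rw [hij])) k hk ?_
        have := dvd_add h (dvd_refl (q : ℤ))
        rwa [show x j - (q - x i) - k + q = x j + x i - k by ring] at this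
      · rw [reflectConfig_neg_coordLabel, reflectConfig_neg_coordLabel] at h
        refine h2 i j (coordLabel_lt_iff.1 (by omega)) k hk ?_
        rwa [show (q : ℤ) - x j - (q - x i) - k = x i - x j - k by ring] at h
    refine ⟨fun s hs => reflectConfig_of_notMem hs, fun s hs => reflectConfig_neg hs,
      fun s hs => ?_, fun s hs t ht hst hst' hle => ?_⟩
    · obtain ⟨i, rfl | rfl⟩ := exists_coordLabel hs
      · rw [reflectConfig_coordLabel, if_pos (coordLabel_pos i)]
        by_contra hlt
        have := hx i
        refine h1 i (x i).toNat (by omega) ?_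
        rw [Int.toNat_of_nonneg this.1, sub_self]
        exact dvd_zero _
      · have := coordLabel_pos i
        have := hx i
        rw [reflectConfig_neg_coordLabel, if_neg (by omega)]
        omega
    · rcases lt_or_gt_of_ne hst with h | h
      · have h4 : (1 : ℤ) + a ≤ reflectConfig m q x t - reflectConfig m q x s := by
          by_contra hlt
          refine core s hs t ht h hst' (reflectConfig m q x t - reflectConfig m q x s).toNat
            (by omega) ?_
          rw [Int.toNat_of_nonneg (by omega), sub_self]
          exact dvd_zero _
        exact ⟨by omega, fun _ _ => h4⟩
      · refine ⟨?_, fun h' => by omega⟩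
        by_contra hlt
        refine core t ht s hs h (by omega) 0 (by omega) ?_
        rw [show reflectConfig m q x s - reflectConfig m q x t - ((0 : ℕ) : ℤ) = 0 by
          push_cast; omega]
        exact dvd_zero _

lemma bHatCount_eq_signedCount {m a q : ℕ} (hq : 0 < q) :
    bHatCount m a q = signedCount 1 a (signedLabels m) 0 q := by
  have : NeZero q := ⟨hq.ne'⟩
  have hneg := (isSignedSet_signedLabels m).2
  have hbd : ∀ x : Fin m → ℤ, reflectConfig m q x ∈ signedConfig 1 a (signedLabels m) 0 q →
      ∀ i, 0 ≤ x i ∧ x i < q := by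
    intro x hp i
    have h1 := hp.2.2.1 _ (coordLabel_mem i)
    have h2 := hp.2.2.1 _ (hneg _ (coordLabel_mem i))
    have h3 := coordLabel_pos i
    rw [reflectConfig_coordLabel, if_pos h3] at h1
    rw [reflectConfig_neg_coordLabel, if_neg (by omega)] at h2
    omega
  rw [bHatCount, signedCount_eq_card]
  refine (Nat.card_congr (Equiv.ofBijective (fun x => ⟨fun i => (x.1 i : ZMod q),
    (reflectConfig_mem_iff (hbd x.1 x.2)).1 x.2⟩) ⟨fun x y h => ?_, fun z => ?_⟩)).symm
  · refine Subtype.ext (funext fun i => ?_)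
    have h1 := congrFun (congrArg Subtype.val h) i
    have hx := hbd x.1 x.2 i
    have hy := hbd y.1 y.2 i
    have h2 := (ZMod.intCast_eq_intCast_iff' _ _ _).1 h1
    rwa [Int.emod_eq_of_lt hx.1 hx.2, Int.emod_eq_of_lt hy.1 hy.2] at h2
  · have h : (fun i => (((z.1 i).val : ℤ) : ZMod q)) = z.1 := by
      funext i; simp
    refine ⟨⟨fun i => ((z.1 i).val : ℤ), (reflectConfig_mem_iff fun i => ?_).2 ?_⟩, ?_⟩
    · exact ⟨by positivity, by exact_mod_cast ZMod.val_lt (z.1 i)⟩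
    · rw [h]; exact z.2
    · exact Subtype.ext h

/-! ### The count as a polynomial for each parity -/

lemma natDegree_phiPoly_le (a : ℕ) : (phiPoly a).natDegree ≤ a - 1 := by
  refine natDegree_sum_le_of_forall_le _ _ fun i hi => ?_
  rw [natDegree_X_pow]
  have := Finset.mem_range.1 hi
  omega

/-- The polynomial `y^{2m} φ_a(y²)^{m-1} φ_a(y)²`. -/
def gapPoly (m a : ℕ) : ℚ[X] :=
  X ^ (2 * m) * (phiPoly a).comp (X ^ 2) ^ (m - 1) * phiPoly a ^ 2

lemma natDegree_gapPoly_le {m a : ℕ} (hm : 0 < m) (ha : 0 < a) :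
    (gapPoly m a).natDegree ≤ 2 * a * m := by
  have h1 := natDegree_phiPoly_le a
  have h2 : ((phiPoly a).comp (X ^ 2)).natDegree ≤ 2 * (a - 1) := by
    rw [natDegree_comp, natDegree_X_pow]; omega
  have h3 : ((phiPoly a).comp (X ^ 2) ^ (m - 1)).natDegree ≤ (m - 1) * (2 * (a - 1)) :=
    natDegree_pow_le_of_le _ h2
  have h4 : (phiPoly a ^ 2).natDegree ≤ 2 * (a - 1) := natDegree_pow_le_of_le _ h1
  have h5 : (X ^ (2 * m) : ℚ[X]).natDegree ≤ 2 * m := natDegree_X_pow_le _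
  refine (natDegree_mul_le_of_le (natDegree_mul_le_of_le h5 h3) h4).trans ?_
  obtain ⟨m, rfl⟩ := Nat.exists_eq_add_of_lt hm
  obtain ⟨a, rfl⟩ := Nat.exists_eq_add_of_lt ha
  simp only [zero_add, Nat.add_sub_cancel]
  nlinarith

/-- The number of points of the complement as a weighted sum over a residue class modulo `a`. -/
lemma bHatCount_mul_pow {m a q : ℕ} (hm : 0 < m) (ha : 0 < a) (hq0 : 0 < q)
    (hq : 2 * a * m ≤ q) :
    (bHatCount m a q : ℚ) * a ^ m = aeval seqShift (gapPoly m a)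
      (fun k : ℤ => if (a : ℤ) ∣ k then (k : ℚ) ^ m else 0) q := by
  have h1 := congrFun (countSeq_eq_aeval_seqDilate ha (m - 1) (signedLabels m) 0
    (isSignedSet_signedLabels m) (by rw [card_signedLabels]; omega)) q
  have h2 : ((X ^ 2 * (phiPoly a).comp (X ^ 2)) ^ (m - 1) * (X * phiPoly a) ^ 2 : ℚ[X]) =
      gapPoly m a := by
    obtain ⟨m, rfl⟩ := Nat.exists_eq_add_of_lt hm
    simp only [gapPoly, zero_add, Nat.add_sub_cancel]
    ring
  have h3 : (bHatCount m a q : ℚ) = countSeq 1 a (signedLabels m) 0 q := by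
    rw [bHatCount_eq_signedCount hq0, countSeq, Nat.cast_one]
  rw [h3, h1, h2, aeval_seqShift_apply, aeval_seqShift_apply, Finset.sum_mul]
  refine Finset.sum_congr rfl fun k hk => ?_
  -- The degree bound `2am` keeps every argument `q - k` nonnegative, so the truncated power in
  -- `signedCount_unit` is the true power.
  have hkq : (k : ℤ) ≤ q := by
    have h4 := natDegree_gapPoly_le hm ha
    have h5 := Finset.mem_range.1 hk
    exact_mod_cast (show k ≤ q by omega)
  rw [seqDilate_apply, mul_assoc]
  congr 1
  have ha' : (a : ℤ) ≠ 0 := by positivity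
  split_ifs with h
  · obtain ⟨c, hc⟩ := h
    have hc0 : 0 ≤ c := by
      by_contra hlt
      have : (a : ℤ) * c < 0 := mul_neg_of_pos_of_neg (by positivity) (by omega)
      omega
    rw [hc, Int.mul_ediv_cancel_left _ ha', countSeq, Nat.cast_zero, Nat.cast_one,
      signedCount_unit]
    have : ((c.toNat : ℕ) : ℚ) = c := by exact_mod_cast Int.toNat_of_nonneg hc0
    push_cast
    rw [this]; ring
  · simp

lemma bHatPolyOddA_eval (m a q : ℕ) :
    (bHatPolyOddA m a).eval (q : ℚ) =
      1 / (a : ℚ) ^ (m + 1) * aeval seqShift (gapPoly m a) (fun k : ℤ => (k : ℚ) ^ m) q := by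
  have h := aeval_shiftOp_eval (gapPoly m a) (X ^ m) q
  simp only [eval_pow, eval_X, Int.cast_natCast] at h
  rw [bHatPolyOddA, eval_smul, smul_eq_mul, ← h]
  simp only [gapPoly, map_mul, map_pow, aeval_X, aeval_comp]

lemma bHatCount_of_odd {m a q : ℕ} (hm : 0 < m) (ha : Odd a) (hq0 : 0 < q)
    (hq : 2 * a * m ≤ q) : (bHatCount m a q : ℚ) = (bHatPolyOddA m a).eval (q : ℚ) := by
  have ha0 : 0 < a := ha.pos
  have hdvd : (phiPoly a).comp (X ^ 1) ^ (m + 1) ∣ gapPoly m a := by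
    rw [pow_one, comp_X, show m + 1 = (m - 1) + 2 by omega, pow_add, gapPoly, mul_assoc]
    exact (mul_dvd_mul (pow_dvd_pow_of_dvd (phiPoly_dvd_comp_X_sq ha) _) dvd_rfl).mul_left _
  have h := aeval_seqShift_residue_class one_pos ha0 hdvd q
  simp only [one_mul, Nat.cast_one, one_dvd, if_true] at h
  rw [bHatPolyOddA_eval, ← h, ← bHatCount_mul_pow hm ha0 hq0 hq]
  have : (a : ℚ) ≠ 0 := by positivity
  field_simp
  ring

/-- The common factor `y^{2m} φ_{2b}(y²)^{m-1} φ_b(y²)²` of the two constituents. -/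
def evenGapPoly (m b : ℕ) : ℚ[X] :=
  X ^ (2 * m) * (phiPoly (2 * b)).comp (X ^ 2) ^ (m - 1) * (phiPoly b).comp (X ^ 2) ^ 2

lemma evenGapPoly_eq_comp (m b : ℕ) : evenGapPoly m b =
    (X ^ m * phiPoly (2 * b) ^ (m - 1) * phiPoly b ^ 2).comp (X ^ 2) := by
  simp only [evenGapPoly, mul_comp, pow_comp, X_comp, ← pow_mul]

/-- From `φ_{2b}(y) = (1 + y) φ_b(y²)` and `(1 + y)² = (1 + y²) + 2y`: the split of `gapPoly` into
even and odd powers of `y`. -/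
lemma gapPoly_two_mul (m b : ℕ) :
    gapPoly m (2 * b) = evenGapPoly m b * (1 + X ^ 2) + C 2 * (X ^ 1 * evenGapPoly m b) := by
  rw [gapPoly, congrArg (· ^ 2) (phiPoly_two_mul b), evenGapPoly, map_ofNat]
  ring

lemma bHatPolyEvenAOddQ_eq (m b : ℕ) : bHatPolyEvenAOddQ m (2 * b) =
    (4 / ((2 * b : ℕ) : ℚ) ^ (m + 1)) • aeval shiftOp (X ^ 1 * evenGapPoly m b) (X ^ m) := by
  rw [bHatPolyEvenAOddQ, Nat.mul_div_cancel_left b two_pos, evenGapPoly, ← mul_assoc, ← mul_assoc,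
    ← pow_add, add_comm 1]
  simp only [map_mul, map_pow, aeval_X, aeval_comp]

lemma bHatPolyEvenAEvenQ_eq (m b : ℕ) : bHatPolyEvenAEvenQ m (2 * b) =
    (2 / ((2 * b : ℕ) : ℚ) ^ (m + 1)) •
      aeval shiftOp (evenGapPoly m b * (1 + X ^ 2)) (X ^ m) := by
  rw [bHatPolyEvenAEvenQ, Nat.mul_div_cancel_left b two_pos, evenGapPoly]
  simp only [map_mul, map_pow, map_add, map_one, aeval_X, aeval_comp]

/-- Replacing `2b ∣ k` by `2 ∣ k` costs a factor `b`, and `1 / (b (2b)^m) = 2 / (2b)^{m+1}`; the odd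
part brings a further 2, whence the constants 2 and 4. -/
lemma bHatCount_of_even {m b q : ℕ} (hm : 0 < m) (hb : 0 < b) (hq0 : 0 < q)
    (hq : 2 * (2 * b) * m ≤ q) :
    (bHatCount m (2 * b) q : ℚ) = if (2 : ℤ) ∣ q then (bHatPolyEvenAEvenQ m (2 * b)).eval (q : ℚ)
      else (bHatPolyEvenAOddQ m (2 * b)).eval (q : ℚ) := by
  have hdvd : (phiPoly b).comp (X ^ 2) ^ (m + 1) ∣ gapPoly m (2 * b) := by
    rw [show m + 1 = (m - 1) + 2 by omega, pow_add, gapPoly, mul_assoc]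
    refine (mul_dvd_mul (pow_dvd_pow_of_dvd ?_ _) (pow_dvd_pow_of_dvd ?_ _)).mul_left _
    · rw [phiPoly_two_mul_comp_X_sq]; exact dvd_mul_right _ _
    · rw [phiPoly_two_mul]; exact dvd_mul_right _ _
  have h := aeval_seqShift_residue_class two_pos hb hdvd q
  rw [← bHatCount_mul_pow hm (by omega) hq0 hq, gapPoly_two_mul, map_add, LinearMap.add_apply,
    Pi.add_apply, aeval_seqShift_mul (C 2), aeval_C, Module.algebraMap_end_apply, Pi.smul_apply,
    smul_eq_mul, aeval_seqShift_mul (X ^ 1), aeval_seqShift_X_pow_apply, Nat.cast_ofNat,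
    evenGapPoly_eq_comp] at h
  have h1 : ((X ^ m * phiPoly (2 * b) ^ (m - 1) * phiPoly b ^ 2).comp (X ^ 2) * (1 + X ^ 2) : ℚ[X])
      = (X ^ m * phiPoly (2 * b) ^ (m - 1) * phiPoly b ^ 2 * (1 + X)).comp (X ^ 2) := by
    rw [mul_comp _ (1 + X)]; simp
  rw [h1, aeval_seqShift_comp_X_sq_even, aeval_seqShift_comp_X_sq_even, ← h1,
    ← evenGapPoly_eq_comp] at h
  beta_reduce at h
  have e1 := aeval_shiftOp_eval (evenGapPoly m b * (1 + X ^ 2)) (X ^ m) q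
  have e2 := aeval_shiftOp_eval (X ^ 1 * evenGapPoly m b) (X ^ m) q
  rw [aeval_seqShift_mul, aeval_seqShift_X_pow_apply] at e2
  simp only [eval_pow, eval_X, Int.cast_natCast] at e1 e2
  rw [bHatPolyEvenAEvenQ_eq, bHatPolyEvenAOddQ_eq, eval_smul, eval_smul, smul_eq_mul, smul_eq_mul,
    e1, e2]
  have hb' : (b : ℚ) ≠ 0 := by positivity
  by_cases h2 : (2 : ℤ) ∣ q
  · rw [if_pos h2] at h ⊢
    -- Even powers of the shift preserve parity and odd ones reverse it, so only one half of
    -- `gapPoly` reaches even arguments.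
    rw [if_neg (by push_cast; omega), mul_zero, add_zero] at h
    rw [← h]
    push_cast
    field_simp
    ring
  · rw [if_neg h2] at h ⊢
    rw [if_pos (by push_cast; omega), zero_add] at h
    have h3 : ∀ y : ℚ, 4 / ((2 * b : ℕ) : ℚ) ^ (m + 1) * y =
      2 / ((2 * b : ℕ) : ℚ) ^ (m + 1) * (2 * y) := fun y => by ring
    rw [h3, ← h]
    push_cast
    field_simp
    ring

/-! ### The two constituents differ -/

lemma coeff_one_sub_shiftOp {f : ℚ[X]} {n : ℕ} (hf : f.natDegree ≤ n + 1) :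
    (f - shiftOp f).coeff n = (n + 1) * f.coeff (n + 1) := by
  rw [coeff_sub, shiftOp, taylor_coeff,
    eval_eq_sum_range' (n := 2) (lt_of_le_of_lt (natDegree_hasseDeriv_le f n) (by omega))]
  simp [Finset.sum_range_succ, hasseDeriv_coeff, add_comm 1 n]

/-- `(1 - S)^n` maps a polynomial of degree `n` to a nonzero constant. -/
lemma one_sub_X_pow_shiftOp (n : ℕ) : ∀ f : ℚ[X], f.natDegree ≤ n → f.coeff n ≠ 0 →
    ∃ c : ℚ, c ≠ 0 ∧ aeval shiftOp ((1 - X) ^ n : ℚ[X]) f = C c := by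
  induction n with
  | zero =>
    intro f hf h0
    refine ⟨f.coeff 0, h0, ?_⟩
    simpa using eq_C_of_natDegree_le_zero hf
  | succ n ih =>
    intro f hf h0
    have hd : (f - shiftOp f).degree < (n + 1 : ℕ) := by
      rw [← degree_neg, neg_sub]
      exact degree_taylor_sub_lt (lt_of_le_of_lt (natDegree_le_iff_degree_le.1 hf)
        (by exact_mod_cast Nat.lt_succ_self _)) _
    obtain ⟨c, hc, h⟩ := ih (f - shiftOp f)
      (natDegree_le_iff_degree_le.2 (degree_le_of_natDegree_le
        (Nat.le_of_lt_succ (by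
          by_cases hz : f - shiftOp f = 0
          · rw [hz]; simp
          · exact (natDegree_lt_iff_degree_lt hz).2 hd))))
      (by rw [coeff_one_sub_shiftOp hf]; exact mul_ne_zero (by positivity) h0)
    refine ⟨c, hc, ?_⟩
    rw [pow_succ, map_mul, Module.End.mul_apply, ← h]
    simp

lemma aeval_shiftOp_C (P : ℚ[X]) (c : ℚ) : aeval shiftOp P (C c) = C (P.eval 1 * c) := by
  have : ∀ k : ℕ, (shiftOp ^ k) (C c) = C c := by
    intro k
    induction k with
    | zero => simp
    | succ k ih => rw [pow_succ, Module.End.mul_apply, shiftOp, taylor_C, ← shiftOp, ih]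
  rw [aeval_eq_sum_range, eval_eq_sum_range, LinearMap.sum_apply, Finset.sum_mul, map_sum]
  refine Finset.sum_congr rfl fun k _ => ?_
  simp [this, smul_eq_C_mul]

lemma phiPoly_eval_one (b : ℕ) : (phiPoly b).eval 1 = b := by
  simp [phiPoly, eval_finsetSum]

/-- Up to a scalar the difference is `(1 - S)² E(S) q^m` with `E = evenGapPoly m b`. Applying `(1 -
S)^{m-2}` turns it into `E(1)` times a nonzero constant, and `E(1) > 0`. -/
lemma bHatPolyEven_ne {m b : ℕ} (hm : 2 ≤ m) (hb : 0 < b) :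
    bHatPolyEvenAOddQ m (2 * b) ≠ bHatPolyEvenAEvenQ m (2 * b) := by
  intro h
  rw [bHatPolyEvenAOddQ_eq, bHatPolyEvenAEvenQ_eq] at h
  have hb' : (b : ℚ) ≠ 0 := by positivity
  have h0 : (2 / ((2 * b : ℕ) : ℚ) ^ (m + 1)) ≠ 0 := by positivity
  rw [show (4 / ((2 * b : ℕ) : ℚ) ^ (m + 1)) = (2 / ((2 * b : ℕ) : ℚ) ^ (m + 1)) * 2 by ring,
    mul_smul] at h
  have h1 := smul_right_injective _ h0 h
  have h2 : aeval shiftOp ((1 - X) ^ 2 * evenGapPoly m b) (X ^ m) = 0 := by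
    rw [show ((1 - X) ^ 2 * evenGapPoly m b : ℚ[X]) =
      evenGapPoly m b * (1 + X ^ 2) - C 2 * (X ^ 1 * evenGapPoly m b) by rw [map_ofNat]; ring,
      map_sub, LinearMap.sub_apply, ← h1, map_mul _ (C 2), aeval_C, Module.End.mul_apply,
      Module.algebraMap_end_apply, sub_self]
  obtain ⟨c, hc, h3⟩ := one_sub_X_pow_shiftOp m (X ^ m) (natDegree_X_pow_le _) (by simp)
  have h4 := congrArg (aeval shiftOp ((1 - X) ^ (m - 2) : ℚ[X])) h2
  rw [← Module.End.mul_apply, ← map_mul, ← mul_assoc, ← pow_add, Nat.sub_add_cancel hm, mul_comm,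
    map_mul, Module.End.mul_apply, h3, aeval_shiftOp_C, map_zero, C_eq_zero] at h4
  refine mul_ne_zero ?_ hc h4
  simp only [evenGapPoly, eval_mul, eval_pow, eval_X, eval_comp, one_pow, phiPoly_eval_one]
  positivity

theorem theorem5p2 (m a : ℕ) (hm : 0 < m) (ha : 0 < a) :
    (Odd a → ∀ q : ℕ, 2 * a * (m + 1) - 1 ≤ q →
      (bHatCount m a q : ℚ) = (bHatPolyOddA m a).eval (q : ℚ)) ∧
    (Even a →
      (∀ q : ℕ, 2 * a * (m + 1) - 1 ≤ q →
        (Odd q → (bHatCount m a q : ℚ) = (bHatPolyEvenAOddQ m a).eval (q : ℚ)) ∧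
        (Even q → (bHatCount m a q : ℚ) = (bHatPolyEvenAEvenQ m a).eval (q : ℚ))) ∧
      (2 ≤ m → bHatPolyEvenAOddQ m a ≠ bHatPolyEvenAEvenQ m a)) := by
  -- The stated bound is `2am + (2a - 1)`, which covers the degree `2am` of the gap polynomial.
  have hbound : ∀ q : ℕ, 2 * a * (m + 1) - 1 ≤ q → 0 < q ∧ 2 * a * m ≤ q := by
    intro q hq
    rw [mul_add, mul_one] at hq
    omega
  refine ⟨fun hodd q hq => bHatCount_of_odd hm hodd (hbound q hq).1 (hbound q hq).2, fun heven => ?_⟩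
  obtain ⟨b, rfl⟩ := heven.two_dvd
  have hb : 0 < b := by omega
  refine ⟨fun q hq => ?_, fun hm2 => bHatPolyEven_ne hm2 hb⟩
  have h := bHatCount_of_even hm hb (hbound q hq).1 (hbound q hq).2
  refine ⟨fun hq' => ?_, fun hq' => ?_⟩
  · rwa [if_neg (by obtain ⟨c, rfl⟩ := hq'; push_cast; omega)] at h
  · rwa [if_pos (by exact_mod_cast hq'.two_dvd)] at h

end
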